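/- Let $m\ge 2$ be an integer, let $1\le i_1<i_2<\cdots<i_\ell\le m-1$ be integers, and let $Y$ be the simple graph with vertex set $Z=\{0,1,\dots,m-1\}$ and edge set $$\{\{1,2\},\{2,3\},\dots,\{m-2,m-1\},\{0,i_1\},\{0,i_2\},\dots,\{0,i_\ell\}\}.$$ Assume that $Y$ is connected (equivalently, $\ell\ge 1$). Define $$\pi_1=\begin{cases}\sum_{t=1}^{\ell}(-1)^t i_t, & \text{if } \ell \text{ is even},\\ \sum_{t=1}^{\ell}(-1)^t i_t+m, & \text{if } \ell\text{ is odd.}\end{cases}$$ Let $\mathcal V$ be the $\mathbb F_2$-vector space of all subsets of $Z$ with symmetric difference as addition. For $v\in Z$ let $N(v)$ be the set of neighbours of $v$ in $Y$, and let $s_v\in \mathrm{GL}(\mathcal V)$ be given by $s_vU=U+N(v)$ if $v\in U$ and $s_vU=U$ otherwise. The vertex-flipping group $\mathbf W_Z(Y)$ is the subgroup of $\mathrm{GL}(\mathcal V)$ generated by all $s_v$, $v\in Z$. Then the following hold. (i) If $Y$ is isomorphic to the line graph of some finite simple connected graph, then $\pi_1\in\{1,2,m-2,m-1\}$. (ii)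 If $\pi_1\in\{1,m-1\}$, then $\mathbf W_Z(Y)$ is isomorphic to the symmetric group $S_{m+1}$. (iii) If $\pi_1\in\{2,m-2\}$, then $\mathbf W_Z(Y)$ is isomorphic to $$\begin{cases}(\mathbb Z/2\mathbb Z)^{m-1}\rtimes S_m, & \text{if } m\text{ is odd},\\ (\mathbb Z/2\mathbb Z)^{m-2}\rtimes S_m, & \text{if } m\text{ is even.}\end{cases}$$ Here, for $m$ odd, $(\mathbb Z/2\mathbb Z)^{m-1}$ stands for the quotient $B=\mathbb F_2^m/\langle(1,\dots,1)\rangle$, and, for $m$ even, $(\mathbb Z/2\mathbb Z)^{m-2}$ stands for the subgroup $B_e\subseteq B$ of the classes of vectors with an even number of ones; these are isomorphic as groups to $(\mathbb Z/2\mathbb Z)^{m-1}$ and $(\mathbb Z/2\mathbb Z)^{m-2}$ respectively, and in both cases $S_m$ acts by permuting the $m$ coordinates. -/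

import Mathlib

namespace FlippingPuzzle

/-- The characteristic vector of the set `N(v)` of neighbours of `v`, as an element of the vertex
space of `X`. The vertex space (the power set of `V` under symmetric difference) is realised as
`V → ZMod 2`, a subset being identified with its characteristic function. -/
noncomputable def nbhd {V : Type*} (X : SimpleGraph V) (v : V) : V → ZMod 2 :=
  (X.neighborSet v).indicator 1

/-- The move `s_v` as a linear endomorphism of the vertex space:
`s_v U = U + N(v)` if `v ∈ U`, and `s_v U = U` otherwise (see `flipMap_of_mem`,
`flipMap_of_notMem`). -/
noncomputable def flipMap {V : Type*} (X : SimpleGraph V) (v : V) :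
    (V → ZMod 2) →ₗ[ZMod 2] (V → ZMod 2) where
  toFun U := U + U v • nbhd X v
  map_add' U U' := by
    simp only [Pi.add_apply, add_smul]
    abel
  map_smul' c U := by
    simp only [Pi.smul_apply, smul_eq_mul, mul_smul, smul_add, RingHom.id_apply]

theorem flipMap_of_mem {V : Type*} (X : SimpleGraph V) (v : V) (U : V → ZMod 2) (h : U v = 1) :
    flipMap X v U = U + nbhd X v := by
  simp [flipMap, h]

theorem flipMap_of_notMem {V : Type*} (X : SimpleGraph V) (v : V) (U : V → ZMod 2)
    (h : U v = 0) : flipMap X v U = U := by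
  simp [flipMap, h]

theorem flipMap_mul_self {V : Type*} (X : SimpleGraph V) (v : V) :
    flipMap X v * flipMap X v = 1 := by
  refine LinearMap.ext fun U => ?_
  have hv : nbhd X v v = 0 := by simp [nbhd]
  have h2 : ∀ W : V → ZMod 2, W + W = 0 := fun W => by
    funext w
    exact CharTwo.add_self_eq_zero (W w)
  change (U + U v • nbhd X v) + (U + U v • nbhd X v) v • nbhd X v = U
  simp [hv, add_assoc, h2]

/-- The move `s_v` as an element of the general linear group of the vertex space. -/
noncomputable def flip {V : Type*} (X : SimpleGraph V) (v : V) :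
    LinearMap.GeneralLinearGroup (ZMod 2) (V → ZMod 2) where
  val := flipMap X v
  inv := flipMap X v
  val_inv := flipMap_mul_self X v
  inv_val := flipMap_mul_self X v

/-- The vertex-flipping group of `X`: the subgroup of the general linear group of the vertex space
generated by the moves `s_v`. -/
noncomputable def vertexFlippingGroup {V : Type*} (X : SimpleGraph V) :
    Subgroup (LinearMap.GeneralLinearGroup (ZMod 2) (V → ZMod 2)) :=
  Subgroup.closure (Set.range (flip X))

/-- The graph on the vertices `0, 1, …, m - 1` with the edges `{1, 2}, {2, 3}, …, {m - 2, m - 1}`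
and `{0, i t}` for `t : Fin l`. -/
def pathWithVertex (m : ℕ) {l : ℕ} (i : Fin l → ℕ) : SimpleGraph (Fin m) :=
  SimpleGraph.fromRel fun a b =>
    (1 ≤ a.val ∧ b.val = a.val + 1) ∨ (a.val = 0 ∧ ∃ t, b.val = i t)

/-- The value `π₁`: writing the indices as `i_1, …, i_l`, it is `∑ (-1)^t i_t` if `l` is even and
`∑ (-1)^t i_t + m` if `l` is odd. Since `Fin l` starts at `0`, `i_t` is `i (t - 1)`. -/
def piOne (m : ℕ) {l : ℕ} (i : Fin l → ℕ) : ℤ :=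
  (∑ t : Fin l, (-1 : ℤ) ^ (t.val + 1) * (i t : ℤ)) + if Even l then 0 else (m : ℤ)

/-- The line spanned by the all-ones vector in `F₂^m`. -/
def allOnes (m : ℕ) : Submodule (ZMod 2) (Fin m → ZMod 2) :=
  Submodule.span (ZMod 2) {fun _ => 1}

/-- The space `F₂^m / ⟨(1, …, 1)⟩`. It is the bond space of any connected graph on `m` vertices:
sending the `v`-th basis vector to the edge cut `E(v)` maps `F₂^m` onto the bond space, and the
only relation is `∑ E(v) = 0`. -/
abbrev Bond (m : ℕ) : Type := (Fin m → ZMod 2) ⧸ allOnes m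

/-- Permutation of coordinates on `F₂^m`, `(σ f)(j) = f (σ⁻¹ j)`; it sends the `v`-th basis vector
to the `σ v`-th one. -/
def permCoord (m : ℕ) (σ : Equiv.Perm (Fin m)) :
    (Fin m → ZMod 2) ≃ₗ[ZMod 2] (Fin m → ZMod 2) :=
  LinearEquiv.funCongrLeft (ZMod 2) (ZMod 2) σ⁻¹

theorem permCoord_apply (m : ℕ) (σ : Equiv.Perm (Fin m)) (f : Fin m → ZMod 2) (j : Fin m) :
    permCoord m σ f j = f (σ⁻¹ j) := rfl

theorem permCoord_single (m : ℕ) (σ : Equiv.Perm (Fin m)) (v : Fin m) :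
    permCoord m σ (Pi.single v 1) = Pi.single (σ v) 1 := by
  funext j
  simp [permCoord_apply, Pi.single_apply, Equiv.symm_apply_eq]

theorem allOnes_map (m : ℕ) (σ : Equiv.Perm (Fin m)) :
    (allOnes m).map (permCoord m σ : (Fin m → ZMod 2) →ₗ[ZMod 2] (Fin m → ZMod 2))
      = allOnes m := by
  rw [allOnes, Submodule.map_span, Set.image_singleton]
  rfl

/-- The action of `S_m` on `F₂^m / ⟨(1, …, 1)⟩` induced by permutation of coordinates. -/
def bondPerm (m : ℕ) (σ : Equiv.Perm (Fin m)) : Bond m ≃ₗ[ZMod 2] Bond m :=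
  Submodule.Quotient.equiv (allOnes m) (allOnes m) (permCoord m σ) (allOnes_map m σ)

theorem bondPerm_mk (m : ℕ) (σ : Equiv.Perm (Fin m)) (f : Fin m → ZMod 2) :
    bondPerm m σ (Submodule.Quotient.mk f) = Submodule.Quotient.mk (permCoord m σ f) := rfl

/-- The coordinate sum on `F₂^m`: the parity of the number of ones. -/
def parity (m : ℕ) : (Fin m → ZMod 2) →ₗ[ZMod 2] ZMod 2 := ∑ j, LinearMap.proj j

/-- The subspace of `F₂^m / ⟨(1, …, 1)⟩` of classes of vectors with an even number of ones. -/
def evenBond (m : ℕ) : Submodule (ZMod 2) (Bond m) :=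
  (LinearMap.ker (parity m)).map (allOnes m).mkQ

theorem evenBond_map (m : ℕ) (σ : Equiv.Perm (Fin m)) :
    (evenBond m).map (bondPerm m σ : Bond m →ₗ[ZMod 2] Bond m) = evenBond m := by
  have key : ∀ τ : Equiv.Perm (Fin m),
      (evenBond m).map (bondPerm m τ : Bond m →ₗ[ZMod 2] Bond m) ≤ evenBond m := by
    rintro τ _ ⟨_, ⟨f, hf, rfl⟩, rfl⟩
    refine ⟨permCoord m τ f, ?_, rfl⟩
    have h : ∑ j, f j = 0 := by simpa [parity] using hf
    have h' : ∑ j, f (τ⁻¹ j) = 0 := by rw [Equiv.sum_comp τ⁻¹ f, h]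
    simpa [parity, permCoord_apply] using h'
  refine le_antisymm (key σ) fun x hx => ⟨bondPerm m σ⁻¹ x, key σ⁻¹ ⟨x, hx, rfl⟩, ?_⟩
  obtain ⟨f, rfl⟩ := Submodule.Quotient.mk_surjective _ x
  change (Submodule.Quotient.mk (permCoord m σ (permCoord m σ⁻¹ f)) : Bond m) = _
  congr 1
  funext j
  simp [permCoord_apply]

/-- The action of `S_m` on `evenBond m` induced by permutation of coordinates. -/
def evenBondPerm (m : ℕ) (σ : Equiv.Perm (Fin m)) : evenBond m ≃ₗ[ZMod 2] evenBond m :=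
  (bondPerm m σ).ofSubmodules (evenBond m) (evenBond m) (evenBond_map m σ)

/-- `bondPerm` as a homomorphism from `S_m` to the automorphism group of the (multiplicatively
written) additive group of `F₂^m / ⟨(1, …, 1)⟩`. -/
def bondAction (m : ℕ) : Equiv.Perm (Fin m) →* MulAut (Multiplicative (Bond m)) where
  toFun σ := AddEquiv.toMultiplicative (bondPerm m σ).toAddEquiv
  map_one' := by
    refine MulEquiv.ext fun x => ?_
    obtain ⟨f, hf⟩ := Submodule.Quotient.mk_surjective _ x.toAdd
    obtain rfl : x = Multiplicative.ofAdd (Submodule.Quotient.mk f) := hf ▸ rfl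
    rfl
  map_mul' σ τ := by
    refine MulEquiv.ext fun x => ?_
    obtain ⟨f, hf⟩ := Submodule.Quotient.mk_surjective _ x.toAdd
    obtain rfl : x = Multiplicative.ofAdd (Submodule.Quotient.mk f) := hf ▸ rfl
    rfl

/-- `evenBondPerm` as a homomorphism from `S_m` to the automorphism group of the (multiplicatively
written) additive group of `evenBond m`. -/
def evenBondAction (m : ℕ) : Equiv.Perm (Fin m) →* MulAut (Multiplicative (evenBond m)) where
  toFun σ := AddEquiv.toMultiplicative (evenBondPerm m σ).toAddEquiv
  map_one' := by
    refine MulEquiv.ext fun x => ?_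
    have h := DFunLike.congr_fun (map_one (bondAction m)) (Multiplicative.ofAdd x.toAdd.1)
    exact Subtype.ext h
  map_mul' σ τ := by
    refine MulEquiv.ext fun x => ?_
    have h := DFunLike.congr_fun (map_mul (bondAction m) σ τ) (Multiplicative.ofAdd x.toAdd.1)
    exact Subtype.ext h

end FlippingPuzzle

namespace FlippingPuzzle

/-! Put the points `0, …, m - 1` on a path and let the vertex `j ≥ 1` stand for the step `{j - 1,
j}`. The neighbours of the vertex `0` are then the steps leaving a set `S` of points, which is
unique up to complement, and `π₁` is the size of such an `S` (`exists_finset_boundary`).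

In a line graph the edges `1, …, m - 1` really form such a path. The points of the path on the edge
`0` form a set of size one or two with the same boundary as `S`, which gives (i).

Conversely, when `S` or its complement has one or two points, the vertex `0` also stands for a pair
of points: `{a, m}` with a new point `m` if `S = {a}`, and `S` itself if it has two points. A
transposition of coordinates adds a multiple of the sum of two basis vectors (`permCoord_swap`), so
under `bondEndpointSum` the transposition of the pair of `v` becomes the move `s_v`.

With one point, the pairs form a tree on `m + 1` points, the bond space has dimension `m`, and the
group is `S_{m+1}`. With two points, the bond space is one dimension short. Adding a coordinate
turns the move at `0` into a transposition followed by a translation, and the group is the affine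
group `evenBond m ⋊ S_m`. Both cases conclude by `vertexFlippingGroup_mulEquiv`. -/

/-! ### Subsets of the path with prescribed boundary. -/

/-- The alternating count of the indices `i t` that are at most `k`; it is the parity, as an element
of `{0, 1}`, of the number of such indices. -/
def altCount {l : ℕ} (i : Fin l → ℕ) (k : ℕ) : ℤ :=
  ∑ t, if i t ≤ k then (-1 : ℤ) ^ t.val else 0

theorem sum_neg_one_pow (l : ℕ) : ∑ t : Fin l, (-1 : ℤ) ^ t.val = if Even l then 0 else 1 := by
  rw [Fin.sum_univ_eq_sum_range (fun t => (-1 : ℤ) ^ t) l, neg_one_geom_sum]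

/-- As `i` increases, the indices counted form an initial segment, so the sum is a truncation of `1
- 1 + 1 - ⋯`. -/
theorem altCount_eq_zero_or_one {l : ℕ} (i : Fin l → ℕ) (hi : StrictMono i) (k : ℕ) :
    altCount i k = 0 ∨ altCount i k = 1 := by
  induction l with
  | zero => simp [altCount]
  | succ l ih =>
    by_cases h : i (Fin.last l) ≤ k
    · have h1 : altCount i k = ∑ t : Fin (l + 1), (-1 : ℤ) ^ t.val :=
        Finset.sum_congr rfl fun t _ => if_pos ((hi.monotone (Fin.le_last t)).trans h)
      rw [h1, sum_neg_one_pow]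
      split_ifs <;> simp
    · have h1 : altCount i k = altCount (i ∘ Fin.castSucc) k := by
        simp [altCount, Fin.sum_univ_castSucc, h]
      rw [h1]
      exact ih _ (hi.comp (Fin.strictMono_castSucc))

theorem altCount_succ {l : ℕ} (i : Fin l → ℕ) (k : ℕ) :
    altCount i (k + 1) = altCount i k + ∑ t, if i t = k + 1 then (-1 : ℤ) ^ t.val else 0 := by
  rw [altCount, altCount, ← Finset.sum_add_distrib]
  refine Finset.sum_congr rfl fun t _ => ?_
  rcases lt_trichotomy (i t) (k + 1) with h | h | h
  · simp [show i t ≤ k + 1 by omega, show i t ≤ k by omega, h.ne]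
  · simp [h]
  · simp [show ¬ i t ≤ k + 1 by omega, show ¬ i t ≤ k by omega, h.ne']

theorem altCount_succ_ne_iff {l : ℕ} (i : Fin l → ℕ) (hi : StrictMono i) (k : ℕ) :
    altCount i (k + 1) ≠ altCount i k ↔ ∃ t, k + 1 = i t := by
  rw [altCount_succ]
  constructor
  · intro h
    by_contra! h'
    exact h (by simp [fun t => (h' t).symm])
  · rintro ⟨t, ht⟩
    simp [ht, hi.injective.eq_iff]

/-- After exchanging the sums, the index `t` is counted for `m - i t` values of `k`; the terms `± m`
cancel in pairs and leave `m` exactly when `l` is odd. -/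
theorem sum_altCount (m : ℕ) {l : ℕ} (i : Fin l → ℕ) (hrange : ∀ t, i t ≤ m) :
    ∑ k ∈ Finset.range m, altCount i k = piOne m i := by
  have h (t : Fin l) : ∑ k ∈ Finset.range m, (if i t ≤ k then (-1 : ℤ) ^ t.val else 0)
      = (-1 : ℤ) ^ (t.val + 1) * i t + m * (-1 : ℤ) ^ t.val := by
    rw [← Finset.sum_filter, Finset.sum_const,
      show (Finset.range m).filter (i t ≤ ·) = Finset.Ico (i t) m by ext; simp [and_comm],
      Nat.card_Ico, nsmul_eq_mul, Nat.cast_sub (hrange t)]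
    ring
  simp only [altCount]
  rw [Finset.sum_comm, Finset.sum_congr rfl fun t _ => h t, Finset.sum_add_distrib,
    ← Finset.mul_sum, sum_neg_one_pow, piOne]
  split_ifs <;> simp

/-- The number `piOne m i` is the size of a set of points on the path `0, 1, …, m - 1` whose
boundary consists of the steps `i t`. -/
theorem exists_finset_boundary (m : ℕ) {l : ℕ} (i : Fin l → ℕ) (hi : StrictMono i)
    (hrange : ∀ t, i t ≤ m) :
    ∃ S ⊆ Finset.range m, (S.card : ℤ) = piOne m i ∧
      ∀ j, j + 1 < m → ((∃ t, j + 1 = i t) ↔ ¬ (j ∈ S ↔ j + 1 ∈ S)) := by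
  refine ⟨(Finset.range m).filter (altCount i · = 1), Finset.filter_subset _ _, ?_, ?_⟩
  · rw [← sum_altCount m i hrange, Finset.card_filter]
    push_cast
    refine Finset.sum_congr rfl fun k _ => ?_
    rcases altCount_eq_zero_or_one i hi k with h | h <;> simp [h]
  · intro j hj
    rw [← altCount_succ_ne_iff i hi]
    have hj' : j < m := by omega
    rcases altCount_eq_zero_or_one i hi j with h | h <;>
      rcases altCount_eq_zero_or_one i hi (j + 1) with h' | h' <;> simp [h, h', hj, hj']

theorem boundary_compl {m : ℕ} {S : Finset ℕ} (P : ℕ → Prop)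
    (hS : ∀ j, j + 1 < m → (P j ↔ ¬ (j ∈ S ↔ j + 1 ∈ S))) (j : ℕ) (hj : j + 1 < m) :
    P j ↔ ¬ (j ∈ Finset.range m \ S ↔ j + 1 ∈ Finset.range m \ S) := by
  have := hS j hj
  have h1 : j < m := by omega
  simp only [Finset.mem_sdiff, Finset.mem_range, h1, hj, true_and]
  tauto

/-- Equal boundaries make the agreement of `S` and `T` at a point constant along the path. -/
theorem eq_or_eq_compl_of_boundary {m : ℕ} {S T : Finset ℕ} (hS : S ⊆ Finset.range m)
    (hT : T ⊆ Finset.range m)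
    (h : ∀ j, j + 1 < m → ((j ∈ S ↔ j + 1 ∈ S) ↔ (j ∈ T ↔ j + 1 ∈ T))) :
    S = T ∨ S = Finset.range m \ T := by
  have key : ∀ j, j < m → ((j ∈ S ↔ j ∈ T) ↔ (0 ∈ S ↔ 0 ∈ T)) := by
    intro j
    induction j with
    | zero => simp
    | succ j ih =>
      intro hj
      rw [← ih (by omega)]
      grind
  by_cases h0 : 0 ∈ S ↔ 0 ∈ T
  · left
    ext j
    by_cases hj : j < m
    · exact (key j hj).2 h0
    · exact iff_of_false (fun h => hj (Finset.mem_range.1 (hS h)))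
        fun h => hj (Finset.mem_range.1 (hT h))
  · right
    ext j
    by_cases hj : j < m
    · have := key j hj
      simp only [Finset.mem_sdiff, Finset.mem_range, hj, true_and]
      grind
    · exact iff_of_false (fun h => hj (Finset.mem_range.1 (hS h))) (by simp [hj])

/-! ### Adjacency in the graph, and line graphs. -/

theorem pathWithVertex_adj_succ (m : ℕ) {l : ℕ} (i : Fin l → ℕ) (a b : Fin m) (ha : 1 ≤ a.val)
    (hb : 1 ≤ b.val) :
    (pathWithVertex m i).Adj a b ↔ b.val = a.val + 1 ∨ a.val = b.val + 1 := by
  simp only [pathWithVertex, SimpleGraph.fromRel_adj, ne_eq, Fin.ext_iff]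
  omega

theorem pathWithVertex_adj_zero (m : ℕ) {l : ℕ} (i : Fin l → ℕ) (a b : Fin m) (ha : a.val = 0)
    (hb : 1 ≤ b.val) :
    (pathWithVertex m i).Adj a b ↔ ∃ t, b.val = i t := by
  simp only [pathWithVertex, SimpleGraph.fromRel_adj, ne_eq, Fin.ext_iff, ha]
  have h1 : ¬ (0 = b.val) := by omega
  have h2 : ¬ (b.val = 0) := by omega
  simp [h1, h2]

/-- Each new edge meets the last one, and it must do so at the free end, because the other end lies
on an earlier edge that the new one avoids. -/
theorem exists_path_of_edges {V : Type*} (e : ℕ → Sym2 V) (m : ℕ)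
    (h1 : ∀ j, 1 ≤ j → j + 1 < m → ∃ x, x ∈ e j ∧ x ∈ e (j + 1))
    (h2 : ∀ j k, 1 ≤ j → j + 1 < k → k < m → ∀ x, x ∈ e j → x ∉ e k) (n : ℕ) (hn : n < m) :
    ∃ p : ℕ → V, ∀ j, j < n → e (j + 1) = s(p j, p (j + 1)) := by
  induction n with
  | zero =>
    -- No edge is constrained yet; `e 0` only provides an element of `V`.
    exact ⟨fun _ => (e 0).out.1, by simp⟩
  | succ n ih =>
    obtain ⟨p, hp⟩ := ih (by omega)
    rcases Nat.eq_zero_or_pos n with rfl | hpos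
    · obtain ⟨x, y, hxy⟩ : ∃ x y, e 1 = s(x, y) := by
        induction e 1 using Sym2.ind with | _ x y => exact ⟨x, y, rfl⟩
      refine ⟨fun j => if j = 0 then x else y, fun j hj => ?_⟩
      obtain rfl : j = 0 := by omega
      simpa using hxy
    · obtain ⟨n, rfl⟩ : ∃ k, n = k + 1 := ⟨n - 1, by omega⟩
      obtain ⟨x, hx, hx'⟩ := h1 (n + 1) (by omega) hn
      obtain ⟨y, hy⟩ := hx'
      rw [hp n (by omega), Sym2.mem_iff] at hx
      rcases hx with rfl | rfl
      · rcases Nat.eq_zero_or_pos n with rfl | hpos'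
        -- A path with a single edge has no preferred direction, so it may have to be reversed.
        · refine ⟨fun j => if j = 0 then p 1 else if j = 1 then p 0 else y, fun j hj => ?_⟩
          obtain rfl | rfl : j = 0 ∨ j = 1 := by omega
          · simpa [Sym2.eq_swap] using hp 0 (by omega)
          · simpa using hy
        · obtain ⟨n, rfl⟩ : ∃ k, n = k + 1 := ⟨n - 1, by omega⟩
          refine absurd ?_ (h2 (n + 1) (n + 1 + 1 + 1) (by omega) (by omega) hn (p (n + 1)) ?_)
          · rw [hy]; simp
          · rw [hp n (by omega)]; simp
      · refine ⟨Function.update p (n + 1 + 1) y, fun j hj => ?_⟩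
        rcases Nat.lt_or_ge j (n + 1) with h | h
        · rw [Function.update_of_ne (by omega), Function.update_of_ne (by omega), hp j h]
        · obtain rfl : j = n + 1 := by omega
          rw [Function.update_of_ne (by omega), Function.update_self, hy]

/-- A coincidence at distance one gives a loop, at distance two a repeated edge, and beyond that two
distant edges that meet. -/
theorem injOn_path_of_edges {V : Type*} (e : ℕ → Sym2 V) (m : ℕ) (p : ℕ → V)
    (hp : ∀ j, j + 1 < m → e (j + 1) = s(p j, p (j + 1)))
    (hdiag : ∀ j, 1 ≤ j → j < m → ¬ (e j).IsDiag)
    (hne : ∀ j, 1 ≤ j → j + 1 < m → e j ≠ e (j + 1))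
    (h2 : ∀ j k, 1 ≤ j → j + 1 < k → k < m → ∀ x, x ∈ e j → x ∉ e k) {a b : ℕ} (hab : a < b)
    (hb : b < m) : p a ≠ p b := by
  intro h
  obtain ⟨b, rfl⟩ : ∃ k, b = k + 1 := ⟨b - 1, by omega⟩
  obtain rfl | rfl | hlt : b = a ∨ b = a + 1 ∨ a + 1 < b := by omega
  · exact hdiag (b + 1) (by omega) hb (by rw [hp b hb]; simpa using h)
  · refine hne (a + 1) (by omega) hb ?_
    rw [hp a (by omega), hp (a + 1) hb, ← h, Sym2.eq_swap]
  · refine h2 (a + 1) (b + 1) (by omega) (by omega) hb (p a) ?_ ?_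
    · rw [hp a (by omega)]; simp
    · rw [hp b hb, h]; simp

theorem exists_index_of_connected {m : ℕ} (hm : 2 ≤ m) {l : ℕ} {i : Fin l → ℕ}
    (hconn : (pathWithVertex m i).Connected) : ∃ t, 1 ≤ i t ∧ i t < m := by
  have : Nontrivial (Fin m) := Fin.nontrivial_iff_two_le.2 hm
  obtain ⟨b, hb⟩ := hconn.preconnected.exists_adj_of_nontrivial (⟨0, by omega⟩ : Fin m)
  have hb0 : 1 ≤ b.val := by
    have := hb.ne
    simp only [ne_eq, Fin.ext_iff] at this
    omega
  obtain ⟨t, ht⟩ := (pathWithVertex_adj_zero m i _ b rfl hb0).1 hb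
  exact ⟨t, by omega, by omega⟩

/-- If the graph is a line graph, then the edges `1, …, m - 1` form a path, and the edge `0` meets
at least one and at most two of its vertices. -/
theorem piOne_mem_of_iso_lineGraph (m : ℕ) (hm : 2 ≤ m) {l : ℕ} (i : Fin l → ℕ) (hi : StrictMono i)
    (hrange : ∀ t, i t ≤ m) (hconn : (pathWithVertex m i).Connected) {V : Type*}
    (X : SimpleGraph V) (φ : pathWithVertex m i ≃g X.lineGraph) :
    piOne m i ∈ ({1, 2, (m : ℤ) - 2, (m : ℤ) - 1} : Set ℤ) := by
  classical
  have hm0 : 0 < m := by omega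
  let e : ℕ → Sym2 V := fun j => if h : j < m then (φ ⟨j, h⟩).1 else (φ ⟨0, hm0⟩).1
  have he (j : ℕ) (h : j < m) : e j = (φ ⟨j, h⟩).1 := dif_pos h
  have hdiag (j : ℕ) (h : j < m) : ¬ (e j).IsDiag := by
    rw [he j h]
    exact X.not_isDiag_of_mem_edgeSet (φ ⟨j, h⟩).2
  have hne (j k : ℕ) (hj : j < m) (hk : k < m) (hjk : j ≠ k) : e j ≠ e k := by
    rw [he j hj, he k hk]
    intro h
    exact hjk (by simpa using φ.injective (Subtype.ext h))
  have hadj (j k : ℕ) (hj : j < m) (hk : k < m) (hjk : j ≠ k) :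
      (pathWithVertex m i).Adj ⟨j, hj⟩ ⟨k, hk⟩ ↔ ∃ x, x ∈ e j ∧ x ∈ e k := by
    rw [← φ.map_adj_iff, SimpleGraph.lineGraph_adj_iff_exists, he j hj, he k hk]
    refine and_iff_right fun h => hjk ?_
    simpa using φ.injective h
  have h2 (j k : ℕ) (hj : 1 ≤ j) (hjk : j + 1 < k) (hk : k < m) (x : V) (hx : x ∈ e j) :
      x ∉ e k := fun hx' => by
    have := (hadj j k (by omega) hk (by omega)).2 ⟨x, hx, hx'⟩
    rw [pathWithVertex_adj_succ m i _ _ hj (show 1 ≤ k by omega)] at this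
    simp only at this
    omega
  obtain ⟨p, hp⟩ := exists_path_of_edges e m
    (fun j hj hjm => (hadj j (j + 1) (by omega) hjm (by omega)).1
      ((pathWithVertex_adj_succ m i _ _ hj (show 1 ≤ j + 1 by omega)).2 (Or.inl rfl)))
    h2 (m - 1) (by omega)
  replace hp (j : ℕ) (hj : j + 1 < m) := hp j (by omega)
  have hinj {a b : ℕ} (hab : a < b) (hb : b < m) : p a ≠ p b :=
    injOn_path_of_edges e m p hp (fun j _ hj => hdiag j hj)
      (fun j _ hj => hne j (j + 1) (by omega) hj (by omega)) h2 hab hb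
  obtain ⟨S, hSm, hcard, hS⟩ := exists_finset_boundary m i hi hrange
  let T : Finset ℕ := (Finset.range m).filter (p · ∈ e 0)
  have hT (j : ℕ) (hj : j + 1 < m) : (∃ t, j + 1 = i t) ↔ ¬ (j ∈ T ↔ j + 1 ∈ T) := by
    have hj' : j < m := by omega
    rw [← pathWithVertex_adj_zero m i ⟨0, hm0⟩ ⟨j + 1, hj⟩ rfl (show 1 ≤ j + 1 by omega),
      hadj 0 (j + 1) hm0 hj (by omega), hp j hj]
    -- Two distinct edges share at most one end, so meeting the edge `0` means that exactly one end
    -- of the step is in `T`.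
    have hnot : ¬ (p j ∈ e 0 ∧ p (j + 1) ∈ e 0) := fun h => by
      have := (Sym2.mem_and_mem_iff (hinj (Nat.lt_succ_self j) hj)).1 h
      exact hne 0 (j + 1) hm0 hj (by omega) (by rw [this, hp j hj])
    simp only [T, Finset.mem_filter, Finset.mem_range, hj, hj', true_and, Sym2.mem_iff,
      and_or_left, exists_or, exists_eq_right]
    tauto
  have hT2 : T.card ≤ 2 := by
    have : T.card ≤ (e 0).toFinset.card := by
      refine Finset.card_le_card_of_injOn p (fun j hj => ?_) fun a ha b hb hab => ?_
      · simpa using (Finset.mem_filter.1 hj).2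
      · have ha' := Finset.mem_range.1 (Finset.mem_filter.1 ha).1
        have hb' := Finset.mem_range.1 (Finset.mem_filter.1 hb).1
        rcases lt_trichotomy a b with h | h | h
        · exact absurd hab (hinj h hb')
        · exact h
        · exact absurd hab.symm (hinj h ha')
    rwa [Sym2.card_toFinset_of_not_isDiag _ (hdiag 0 hm0)] at this
  -- Connectedness provides a boundary step, and the empty set has none.
  have hT0 : 0 < T.card := by
    obtain ⟨t, ht, htm⟩ := exists_index_of_connected hm hconn
    have := (hT (i t - 1) (by omega)).1 ⟨t, by omega⟩
    rw [Finset.card_pos]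
    by_contra h
    rw [Finset.not_nonempty_iff_eq_empty] at h
    simp [h] at this
  have hTm : T.card ≤ m := by simpa using Finset.card_le_card (Finset.filter_subset _ _ : T ⊆ _)
  have hc : (S.card : ℤ) = T.card ∨ (S.card : ℤ) = m - T.card := by
    rcases eq_or_eq_compl_of_boundary hSm (Finset.filter_subset _ _ : T ⊆ _) fun j hj =>
      not_iff_not.1 ((hS j hj).symm.trans (hT j hj)) with h | h
    · exact Or.inl (by rw [h])
    · right
      rw [h, Finset.card_sdiff_of_subset (Finset.filter_subset _ _), Finset.card_range,
        Nat.cast_sub hTm]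
  rw [← hcard]
  simp only [Set.mem_insert_iff, Set.mem_singleton_iff]
  omega

/-! ### Identifying the flipping group through a faithful representation. -/

theorem vertexFlippingGroup_mulEquiv {V G M : Type*} [Group G] [AddCommGroup M]
    [Module (ZMod 2) M] (X : SimpleGraph V) (ρ : G →* Module.End (ZMod 2) M)
    (hρ : Function.Injective ρ) (Φ : M ≃ₗ[ZMod 2] (V → ZMod 2)) (g : V → G)
    (hg : Subgroup.closure (Set.range g) = ⊤)
    (h : ∀ v x, Φ (ρ (g v) x) = flipMap X v (Φ x)) :
    Nonempty (vertexFlippingGroup X ≃* G) := by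
  let θ₀ : G →* Module.End (ZMod 2) (V → ZMod 2) :=
    { toFun := fun a => Φ.conj (ρ a)
      map_one' := by ext; simp [LinearEquiv.conj_apply]
      map_mul' := fun a b => by ext; simp [LinearEquiv.conj_apply] }
  let θ : G →* LinearMap.GeneralLinearGroup (ZMod 2) (V → ZMod 2) := θ₀.toHomUnits
  have hθ : Function.Injective θ := fun a b hab => by
    have h1 : Φ.conj (ρ a) = Φ.conj (ρ b) := congrArg Units.val hab
    exact hρ (Φ.conj.injective h1)
  have hgen (v : V) : θ (g v) = flip X v := by
    refine Units.ext (LinearMap.ext fun U => ?_)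
    change Φ (ρ (g v) (Φ.symm U)) = flipMap X v U
    rw [h, LinearEquiv.apply_symm_apply]
  have hrange : θ.range = vertexFlippingGroup X := by
    rw [MonoidHom.range_eq_map, ← hg, MonoidHom.map_closure, vertexFlippingGroup, ← Set.range_comp]
    congr 2
    funext v
    exact hgen v
  exact ⟨((MonoidHom.ofInjective hθ).trans (MulEquiv.subgroupCongr hrange)).symm⟩

/-! ### The bond space -/

theorem mem_allOnes_iff (n : ℕ) (f : Fin n → ZMod 2) :
    f ∈ allOnes n ↔ ∃ c : ZMod 2, ∀ j, f j = c := by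
  rw [allOnes, Submodule.mem_span_singleton]
  refine exists_congr fun c => ?_
  rw [eq_comm, funext_iff]
  simp

theorem finrank_bond (n : ℕ) (hn : 0 < n) : Module.finrank (ZMod 2) (Bond n) = n - 1 := by
  have h := (allOnes n).finrank_quotient_add_finrank
  have h1 : Module.finrank (ZMod 2) (allOnes n) = 1 :=
    finrank_span_singleton fun h0 => one_ne_zero (congrFun h0 ⟨0, hn⟩)
  rw [h1, Module.finrank_fin_fun] at h
  exact Nat.eq_sub_of_add_eq h

theorem parity_apply (n : ℕ) (f : Fin n → ZMod 2) : parity n f = ∑ j, f j := by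
  simp [parity]

/-- For even `n` the all-ones vector is even, so `parity` descends to a nonzero functional on the
bond space, with kernel `evenBond n`. -/
theorem finrank_evenBond (n : ℕ) (hn : 0 < n) (he : Even n) :
    Module.finrank (ZMod 2) (evenBond n) = n - 2 := by
  have hle : allOnes n ≤ LinearMap.ker (parity n) := fun f hf => by
    obtain ⟨c, hc⟩ := (mem_allOnes_iff n f).1 hf
    rw [LinearMap.mem_ker, parity_apply]
    simp [hc, (ZMod.natCast_eq_zero_iff_even).2 he]
  have hker : evenBond n = LinearMap.ker ((allOnes n).liftQ (parity n) hle) := by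
    rw [Submodule.ker_liftQ]
    rfl
  have hrange : LinearMap.range ((allOnes n).liftQ (parity n) hle) = ⊤ := by
    rw [Submodule.range_liftQ, LinearMap.range_eq_top]
    intro c
    exact ⟨Pi.single ⟨0, hn⟩ c, by simp [parity_apply]⟩
  have h := LinearMap.finrank_range_add_finrank_ker ((allOnes n).liftQ (parity n) hle)
  rw [← hker, hrange, finrank_top, Module.finrank_self, finrank_bond n hn] at h
  have h' : 1 + Module.finrank (ZMod 2) (evenBond n) = n - 1 := h
  omega

theorem evenBond_eq_top (n : ℕ) (hn : Odd n) : evenBond n = ⊤ := by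
  rw [eq_top_iff]
  rintro x -
  obtain ⟨f, rfl⟩ := Submodule.Quotient.mk_surjective _ x
  -- For odd `n`, adding the all-ones vector corrects the parity without changing the class.
  refine ⟨f + fun _ => parity n f, ?_, ?_⟩
  · have h1 : parity n (fun _ => parity n f) = parity n f := by
      rw [parity_apply n fun _ => _]
      simp [(ZMod.natCast_eq_one_iff_odd).2 hn]
    rw [SetLike.mem_coe, LinearMap.mem_ker, map_add, h1]
    exact CharTwo.add_self_eq_zero _
  · rw [Submodule.mkQ_apply, Submodule.Quotient.eq]
    exact (mem_allOnes_iff n _).2 ⟨parity n f, fun j => by simp⟩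

theorem nonempty_addEquiv_of_finrank {M : Type*} [AddCommGroup M] [Module (ZMod 2) M]
    [Module.Finite (ZMod 2) M] (k : ℕ) (h : Module.finrank (ZMod 2) M = k) :
    Nonempty (M ≃+ (Fin k → ZMod 2)) :=
  ⟨(LinearEquiv.ofFinrankEq M (Fin k → ZMod 2) (by rw [h, Module.finrank_fin_fun])).toAddEquiv⟩

/-- The sum of two basis vectors. -/
def pairVec {n : ℕ} (a b : Fin n) : Fin n → ZMod 2 := Pi.single a 1 + Pi.single b 1

/-- This transvection form of a transposition is what matches it with a move `s_v`. -/
theorem permCoord_swap {n : ℕ} (a b : Fin n) (f : Fin n → ZMod 2) :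
    permCoord n (Equiv.swap a b) f = f + (f a + f b) • pairVec a b := by
  funext j
  rw [permCoord_apply, Equiv.swap_inv]
  have key : ∀ x y : ZMod 2, y = x + (x + y) ∧ x = y + (x + y) := by decide
  by_cases hab : a = b
  · subst hab
    simp [pairVec, CharTwo.add_self_eq_zero]
  · by_cases ha : j = a
    · subst ha
      simpa [pairVec, Pi.single_apply, hab] using (key (f j) (f b)).1
    · by_cases hb : j = b
      · subst hb
        simpa [pairVec, Pi.single_apply, ha] using (key (f a) (f j)).2
      · simp [pairVec, ha, hb, Equiv.swap_apply_of_ne_of_ne]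

theorem bondPerm_one (n : ℕ) (x : Bond n) : bondPerm n 1 x = x :=
  DFunLike.congr_fun (map_one (bondAction n)) (Multiplicative.ofAdd x)

theorem bondPerm_mul (n : ℕ) (σ τ : Equiv.Perm (Fin n)) (x : Bond n) :
    bondPerm n (σ * τ) x = bondPerm n σ (bondPerm n τ x) :=
  DFunLike.congr_fun (map_mul (bondAction n) σ τ) (Multiplicative.ofAdd x)

/-- For `n ≥ 3` the symmetric group acts faithfully on the bond space. -/
theorem bondPerm_faithful (n : ℕ) (hn : 3 ≤ n) {σ τ : Equiv.Perm (Fin n)}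
    (h : ∀ x, bondPerm n σ x = bondPerm n τ x) : σ = τ := by
  refine Equiv.ext fun c => ?_
  have h1 := h (Submodule.Quotient.mk (Pi.single c 1))
  rw [bondPerm_mk, bondPerm_mk, permCoord_single, permCoord_single, Submodule.Quotient.eq,
    mem_allOnes_iff] at h1
  obtain ⟨z, hz⟩ := h1
  by_contra hne
  -- The difference of the two basis vectors is constant; it vanishes at a third coordinate `d` but
  -- not at `σ c`.
  obtain ⟨d, hd⟩ : ∃ d : Fin n, d ∉ ({σ c, τ c} : Finset (Fin n)) := by
    by_contra! hall
    have := Finset.card_le_card fun x (_ : x ∈ Finset.univ) => hall x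
    have h2 := Finset.card_le_two (a := σ c) (b := τ c)
    rw [Finset.card_univ, Fintype.card_fin] at this
    omega
  simp only [Finset.mem_insert, Finset.mem_singleton, not_or] at hd
  have h3 := hz d
  have h4 := hz (σ c)
  simp only [Pi.sub_apply, Pi.single_apply, hd.1, hd.2, if_false, if_true, hne] at h3 h4
  rw [← h3] at h4
  simp at h4

/-! ### Transpositions attached to the vertices -/

/-- The linear map `h ↦ (w ↦ h (p w) + h (q w))`. -/
def endpointSum {m n : ℕ} (p q : Fin m → Fin n) : (Fin n → ZMod 2) →ₗ[ZMod 2] (Fin m → ZMod 2) :=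
  LinearMap.funLeft (ZMod 2) (ZMod 2) p + LinearMap.funLeft (ZMod 2) (ZMod 2) q

theorem endpointSum_apply {m n : ℕ} (p q : Fin m → Fin n) (h : Fin n → ZMod 2) (w : Fin m) :
    endpointSum p q h w = h (p w) + h (q w) := rfl

theorem allOnes_le_ker_endpointSum {m n : ℕ} (p q : Fin m → Fin n) :
    allOnes n ≤ LinearMap.ker (endpointSum p q) := fun f hf => by
  obtain ⟨c, hc⟩ := (mem_allOnes_iff n f).1 hf
  rw [LinearMap.mem_ker]
  funext w
  rw [endpointSum_apply, hc, hc]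
  exact CharTwo.add_self_eq_zero c

/-- The map induced by `endpointSum` on the bond space. -/
def bondEndpointSum {m n : ℕ} (p q : Fin m → Fin n) : Bond n →ₗ[ZMod 2] (Fin m → ZMod 2) :=
  (allOnes n).liftQ (endpointSum p q) (allOnes_le_ker_endpointSum p q)

theorem bondEndpointSum_mk {m n : ℕ} (p q : Fin m → Fin n) (h : Fin n → ZMod 2) :
    bondEndpointSum p q (Submodule.Quotient.mk h) = endpointSum p q h := rfl

/-- The two points `p v` and `q v` attached to each vertex `v` describe the graph: `v` and `w` are
adjacent if and only if `{p v, q v}` and `{p w, q w}` meet in an odd number of points. The vertices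
`1, 2, …` are attached to the steps of a path. -/
structure IsEndpoints {m n : ℕ} (X : SimpleGraph (Fin m)) (p q : Fin m → Fin n) : Prop where
  ne : ∀ v, p v ≠ q v
  endpointSum_pairVec : ∀ v, endpointSum p q (pairVec (p v) (q v)) = nbhd X v
  left : ∀ v : Fin m, 1 ≤ v.val → (p v).val = v.val - 1
  right : ∀ v : Fin m, 1 ≤ v.val → (q v).val = v.val

theorem pairVec_add_pairVec_eq {n : ℕ} (a b c d : Fin n) (hab : a ≠ b) :
    pairVec a b c + pairVec a b d
      = if ((c = a ∨ c = b) ↔ (d = a ∨ d = b)) then 0 else 1 := by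
  simp only [pairVec, Pi.add_apply, Pi.single_apply]
  have h1 : (1 : ZMod 2) + 1 = 0 := by decide
  by_cases h1 : c = a <;> by_cases h2 : c = b <;> by_cases h3 : d = a <;> by_cases h4 : d = b <;>
    simp_all

/-- Two distinct steps share one point exactly when they are consecutive, and a step meets `{a, b}`
in one point exactly when it lies on the boundary of that pair. -/
theorem isEndpoints_pathWithVertex {m n : ℕ} {l : ℕ} (i : Fin l → ℕ) (hmn : m ≤ n)
    (a b : Fin n) (hab : a ≠ b)
    (h : ∀ j, j + 1 < m →
      ((∃ t, j + 1 = i t) ↔ ¬ ((j = a ∨ j = b) ↔ (j + 1 = a ∨ j + 1 = b)))) :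
    IsEndpoints (pathWithVertex m i)
      (fun v => if v.val = 0 then a else ⟨v.val - 1, by omega⟩)
      (fun v => if v.val = 0 then b else ⟨v.val, by omega⟩) := by
  classical
  have hne : ∀ v : Fin m, (if v.val = 0 then a else (⟨v.val - 1, by omega⟩ : Fin n)) ≠
      if v.val = 0 then b else ⟨v.val, by omega⟩ := fun v => by
    split_ifs with h0
    · exact hab
    · simp only [ne_eq, Fin.mk.injEq]
      omega
  refine ⟨hne, fun v => ?_, fun v hv => ?_, fun v hv => ?_⟩
  · funext w
    rw [endpointSum_apply, pairVec_add_pairVec_eq _ _ _ _ (hne v), nbhd, Set.indicator_apply]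
    simp only [SimpleGraph.mem_neighborSet, Pi.one_apply]
    rw [← ite_not]
    refine if_congr ?_ rfl rfl
    rcases Nat.eq_zero_or_pos v.val with hv | hv <;> rcases Nat.eq_zero_or_pos w.val with hw | hw
    · obtain rfl : v = w := Fin.ext (by omega)
      simp [hv]
    · rw [pathWithVertex_adj_zero m i v w hv hw]
      have := h (w.val - 1) (by omega)
      rw [Nat.sub_add_cancel hw] at this
      rw [this]
      simp [hv, show w.val ≠ 0 by omega, Fin.ext_iff]
    · rw [SimpleGraph.adj_comm, pathWithVertex_adj_zero m i w v hw hv]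
      have := h (v.val - 1) (by omega)
      rw [Nat.sub_add_cancel hv] at this
      rw [this]
      simp only [hw, show v.val ≠ 0 by omega, Fin.ext_iff, if_true, if_false]
      have hab' : a.val ≠ b.val := fun h => hab (Fin.ext h)
      omega
    · rw [pathWithVertex_adj_succ m i v w hv hw]
      simp only [show v.val ≠ 0 by omega, show w.val ≠ 0 by omega, Fin.ext_iff, if_false]
      omega
  · simp [show v.val ≠ 0 by omega]
  · simp [show v.val ≠ 0 by omega]

namespace IsEndpoints

variable {m n : ℕ} {X : SimpleGraph (Fin m)} {p q : Fin m → Fin n}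

theorem endpointSum_permCoord_swap (hX : IsEndpoints X p q) (v : Fin m) (f : Fin n → ZMod 2) :
    endpointSum p q (permCoord n (Equiv.swap (p v) (q v)) f)
      = endpointSum p q f + (f (p v) + f (q v)) • nbhd X v := by
  rw [permCoord_swap, map_add, map_smul, hX.endpointSum_pairVec]

/-- Source of injectivity modulo the all-ones vector. Only the points below `m` are reached; for `n
= m + 1` the last point is off the path. -/
theorem eq_zero_of_endpointSum (hX : IsEndpoints X p q) {f : Fin n → ZMod 2}
    (hf : ∀ v : Fin m, 1 ≤ v.val → f (p v) + f (q v) = 0) (j : ℕ) (hj : j < m) (hn : j < n) :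
    f ⟨j, hn⟩ = f ⟨0, by omega⟩ := by
  induction j with
  | zero => rfl
  | succ j ih =>
    have h := hf ⟨j + 1, hj⟩ (by simp)
    have hp : p ⟨j + 1, hj⟩ = ⟨j, by omega⟩ := Fin.ext (hX.left ⟨j + 1, hj⟩ (by simp))
    have hq : q ⟨j + 1, hj⟩ = ⟨j + 1, hn⟩ := Fin.ext (hX.right ⟨j + 1, hj⟩ (by simp))
    rw [hp, hq, CharTwo.add_eq_zero] at h
    rw [← h, ih (by omega)]

theorem exists_mem_closure_apply (hX : IsEndpoints X p q) (H : Subgroup (Equiv.Perm (Fin n)))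
    (hH : ∀ v : Fin m, 1 ≤ v.val → Equiv.swap (p v) (q v) ∈ H) (j : ℕ) (hj : j < m) (hn : j < n) :
    ∃ σ ∈ H, σ ⟨0, by omega⟩ = ⟨j, hn⟩ := by
  induction j with
  | zero => exact ⟨1, one_mem _, rfl⟩
  | succ j ih =>
    obtain ⟨σ, hσ, h⟩ := ih (by omega) (by omega)
    have hp : p ⟨j + 1, hj⟩ = ⟨j, by omega⟩ := Fin.ext (hX.left ⟨j + 1, hj⟩ (by simp))
    have hq : q ⟨j + 1, hj⟩ = ⟨j + 1, hn⟩ := Fin.ext (hX.right ⟨j + 1, hj⟩ (by simp))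
    refine ⟨Equiv.swap (p ⟨j + 1, hj⟩) (q ⟨j + 1, hj⟩) * σ, mul_mem (hH _ (by simp)) hσ, ?_⟩
    rw [Equiv.Perm.mul_apply, h, hp, Equiv.swap_apply_left, hq]

end IsEndpoints

theorem closure_eq_top_of_swaps {n : ℕ} (S : Set (Equiv.Perm (Fin n))) (hS : ∀ σ ∈ S, σ.IsSwap)
    (a : Fin n) (h : ∀ b, ∃ σ ∈ Subgroup.closure S, σ a = b) : Subgroup.closure S = ⊤ := by
  have : MulAction.IsPretransitive (Subgroup.closure S) (Fin n) :=
    (MulAction.isPretransitive_iff_base a).2 fun b => by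
      obtain ⟨σ, hσ, hb⟩ := h b
      exact ⟨⟨σ, hσ⟩, hb⟩
  exact closure_of_isSwap_of_isPretransitive hS

namespace IsEndpoints

variable {m n : ℕ} {X : SimpleGraph (Fin m)} {p q : Fin m → Fin n}

theorem bondEndpointSum_bondPerm_swap (hX : IsEndpoints X p q) (v : Fin m) (x : Bond n) :
    bondEndpointSum p q (bondPerm n (Equiv.swap (p v) (q v)) x)
      = bondEndpointSum p q x + bondEndpointSum p q x v • nbhd X v := by
  obtain ⟨f, rfl⟩ := Submodule.Quotient.mk_surjective _ x
  rw [bondPerm_mk, bondEndpointSum_mk, bondEndpointSum_mk, hX.endpointSum_permCoord_swap,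
    endpointSum_apply]

/-- If the vertex `v₀` joins a point of the path to the point outside it, then the transpositions of
endpoints are attached to the edges of a tree, and they generate the symmetric group. -/
theorem vertexFlippingGroup_mulEquiv_perm {p q : Fin m → Fin (m + 1)} (hX : IsEndpoints X p q)
    (hm : 2 ≤ m) (v₀ : Fin m) (hp : (p v₀).val < m) (hq : (q v₀).val = m) :
    Nonempty (vertexFlippingGroup X ≃* Equiv.Perm (Fin (m + 1))) := by
  have hinj : Function.Injective (bondEndpointSum p q) := by
    rw [injective_iff_map_eq_zero]
    intro x hx
    obtain ⟨f, rfl⟩ := Submodule.Quotient.mk_surjective _ x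
    rw [bondEndpointSum_mk] at hx
    have h0 := hX.eq_zero_of_endpointSum (fun v _ => congrFun hx v)
    rw [Submodule.Quotient.mk_eq_zero, mem_allOnes_iff]
    refine ⟨f ⟨0, by omega⟩, fun j => ?_⟩
    -- The point `m` is off the path; only the condition at `v₀` ties it to the rest.
    rcases Nat.lt_or_ge j.val m with hj | hj
    · exact h0 j.val hj j.2
    · have h1 : f (p v₀) + f (q v₀) = 0 := congrFun hx v₀
      obtain rfl : j = q v₀ := Fin.ext (by omega)
      rw [CharTwo.add_eq_zero] at h1
      rw [← h1]
      exact h0 _ hp (p v₀).2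
  let ρ : Equiv.Perm (Fin (m + 1)) →* Module.End (ZMod 2) (Bond (m + 1)) :=
    { toFun := fun σ => (bondPerm (m + 1) σ).toLinearMap
      map_one' := LinearMap.ext fun x => bondPerm_one _ x
      map_mul' := fun σ τ => LinearMap.ext fun x => bondPerm_mul _ σ τ x }
  refine vertexFlippingGroup_mulEquiv X ρ
    (fun σ τ h => bondPerm_faithful (m + 1) (by omega) fun x => LinearMap.congr_fun h x)
    (LinearEquiv.ofInjectiveOfFinrankEq (bondEndpointSum p q) hinj
      (by rw [finrank_bond _ (by omega), Module.finrank_fin_fun]; rfl))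
    (fun v => Equiv.swap (p v) (q v)) ?_ fun v x => hX.bondEndpointSum_bondPerm_swap v x
  have hgen (v : Fin m) : Equiv.swap (p v) (q v) ∈
      Subgroup.closure (Set.range fun v => Equiv.swap (p v) (q v)) :=
    Subgroup.subset_closure ⟨v, rfl⟩
  refine closure_eq_top_of_swaps _ ?_ ⟨0, by omega⟩ fun b => ?_
  · rintro _ ⟨v, rfl⟩
    exact ⟨_, _, hX.ne v, rfl⟩
  · rcases Nat.lt_or_ge b.val m with hb | hb
    · exact hX.exists_mem_closure_apply _ (fun v _ => hgen v) b.val hb b.2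
    · obtain ⟨σ, hσ, h⟩ :=
        hX.exists_mem_closure_apply _ (fun v _ => hgen v) (p v₀).val hp (p v₀).2
      refine ⟨Equiv.swap (p v₀) (q v₀) * σ, mul_mem (hgen v₀) hσ, ?_⟩
      rw [Equiv.Perm.mul_apply, h, Equiv.swap_apply_left]
      exact Fin.ext (by omega)

end IsEndpoints

/-! ### The even part of the bond space and the affine group. -/

theorem parity_pairVec {n : ℕ} (a b : Fin n) : parity n (pairVec a b) = 0 := by
  rw [pairVec, map_add, parity_apply, parity_apply]
  simp [CharTwo.add_self_eq_zero]

/-- The class of `pairVec a b` in the even part of the bond space. -/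
def evenPair {n : ℕ} (a b : Fin n) : evenBond n :=
  ⟨Submodule.Quotient.mk (pairVec a b), pairVec a b, parity_pairVec a b, rfl⟩

theorem evenBondPerm_evenPair {n : ℕ} (σ : Equiv.Perm (Fin n)) (a b : Fin n) :
    evenBondPerm n σ (evenPair a b) = evenPair (σ a) (σ b) := by
  refine Subtype.ext ?_
  change bondPerm n σ (Submodule.Quotient.mk (pairVec a b)) = Submodule.Quotient.mk _
  rw [bondPerm_mk, pairVec, map_add, permCoord_single, permCoord_single, pairVec]

theorem evenPair_self {n : ℕ} (a : Fin n) : evenPair a a = 0 := by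
  refine Subtype.ext ?_
  change Submodule.Quotient.mk (pairVec a a) = _
  rw [pairVec, show (Pi.single a 1 + Pi.single a 1 : Fin n → ZMod 2) = 0 from
    funext fun j => CharTwo.add_self_eq_zero _]
  rfl

/-- An even vector is the sum of the pairs `{c, o}` over its support, since the copies of the basis
vector at `o` cancel. -/
theorem eq_top_of_evenPair_mem {n : ℕ} (o : Fin n) (H : AddSubgroup (evenBond n))
    (h : ∀ c, evenPair c o ∈ H) : H = ⊤ := by
  rw [eq_top_iff]
  rintro ⟨_, f, hf, rfl⟩ -
  rw [SetLike.mem_coe, LinearMap.mem_ker, parity_apply] at hf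
  have hsum : (⟨(allOnes n).mkQ f, f, by rwa [SetLike.mem_coe, LinearMap.mem_ker, parity_apply],
      rfl⟩ : evenBond n) = ∑ c, f c • evenPair c o := by
    refine Subtype.ext ?_
    rw [AddSubmonoidClass.coe_finsetSum]
    change (allOnes n).mkQ f = ∑ c, f c • (allOnes n).mkQ (pairVec c o)
    simp only [← map_smul, ← map_sum]
    congr 1
    simp only [pairVec, smul_add, Finset.sum_add_distrib, ← Finset.sum_smul, hf, zero_smul,
      add_zero]
    funext j
    simp [Finset.sum_apply, Pi.single_apply]
  rw [hsum]
  refine sum_mem fun c _ => ?_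
  have : ∀ z : ZMod 2, z = 0 ∨ z = 1 := by decide
  rcases this (f c) with h0 | h0
  · simp [h0]
  · simpa [h0] using h c

theorem exists_perm_apply_pair {α : Type*} [DecidableEq α] {a b c d : α} (hab : a ≠ b)
    (hcd : c ≠ d) : ∃ σ : Equiv.Perm α, σ a = c ∧ σ b = d := by
  -- Send `a` to `c`, then carry the image of `b` to `d` while fixing `c`.
  refine ⟨Equiv.swap (Equiv.swap a c b) d * Equiv.swap a c, ?_, ?_⟩
  · rw [Equiv.Perm.mul_apply, Equiv.swap_apply_left, Equiv.swap_apply_of_ne_of_ne _ hcd]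
    intro h
    apply hab
    apply (Equiv.swap a c).injective
    rw [Equiv.swap_apply_left, ← h]
  · rw [Equiv.Perm.mul_apply, Equiv.swap_apply_left]

/-- The affine action of `evenBond n ⋊ S_n` on `Bond n × F₂`. -/
def affineAction (n : ℕ) :
    Multiplicative (evenBond n) ⋊[evenBondAction n] Equiv.Perm (Fin n) →*
      Module.End (ZMod 2) (Bond n × ZMod 2) where
  toFun g :=
    ((bondPerm n g.right).toLinearMap.comp (LinearMap.fst _ _ _) +
      (LinearMap.toSpanSingleton (ZMod 2) (Bond n) (g.left.toAdd : Bond n)).comp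
        (LinearMap.snd _ _ _)).prod (LinearMap.snd _ _ _)
  map_one' := by
    refine LinearMap.ext fun x => Prod.ext ?_ rfl
    change bondPerm n 1 x.1 + x.2 • (0 : Bond n) = x.1
    rw [bondPerm_one, smul_zero, add_zero]
  map_mul' g h := by
    refine LinearMap.ext fun x => Prod.ext ?_ rfl
    change bondPerm n (g.right * h.right) x.1 +
        x.2 • ((g.left.toAdd : Bond n) + bondPerm n g.right (h.left.toAdd : Bond n))
      = bondPerm n g.right (bondPerm n h.right x.1 + x.2 • (h.left.toAdd : Bond n))
        + x.2 • (g.left.toAdd : Bond n)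
    rw [bondPerm_mul, map_add, map_smul, smul_add]
    abel

theorem affineAction_apply (n : ℕ)
    (g : Multiplicative (evenBond n) ⋊[evenBondAction n] Equiv.Perm (Fin n))
    (x : Bond n × ZMod 2) :
    affineAction n g x = (bondPerm n g.right x.1 + x.2 • (g.left.toAdd : Bond n), x.2) := rfl

/-- The permutation is read off at the vectors `(x, 0)`, the translation at `(0, 1)`. -/
theorem affineAction_injective (n : ℕ) (hn : 3 ≤ n) : Function.Injective (affineAction n) := by
  intro g h hgh
  have key (x : Bond n) (c : ZMod 2) : bondPerm n g.right x + c • (g.left.toAdd : Bond n)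
      = bondPerm n h.right x + c • (h.left.toAdd : Bond n) :=
    congrArg Prod.fst (LinearMap.congr_fun hgh (x, c))
  refine SemidirectProduct.ext (Multiplicative.toAdd.injective (Subtype.ext ?_))
    (bondPerm_faithful n hn fun x => by simpa using key x 0)
  simpa using key 0 1

namespace IsEndpoints

variable {m : ℕ} {X : SimpleGraph (Fin m)} {p q : Fin m → Fin m}

/-- The element of `evenBond m ⋊ S_m` acting as the move at `v`. -/
def generator (p q : Fin m → Fin m) (v : Fin m) :
    Multiplicative (evenBond m) ⋊[evenBondAction m] Equiv.Perm (Fin m) :=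
  ⟨if v.val = 0 then Multiplicative.ofAdd (evenPair (p v) (q v)) else 1, Equiv.swap (p v) (q v)⟩

/-- The steps of the path already generate the factor `S_m`. Cancelling the transposition of the
generator at `0` leaves one translation by a pair, and its conjugates under the 2-transitive `S_m`
generate all translations. -/
theorem closure_generator (hX : IsEndpoints X p q) (hm : 0 < m) :
    Subgroup.closure (Set.range (generator p q)) = ⊤ := by
  set H := Subgroup.closure (Set.range (generator p q))
  have hgen (v : Fin m) : generator p q v ∈ H := Subgroup.subset_closure ⟨v, rfl⟩
  have hinr (σ : Equiv.Perm (Fin m)) : SemidirectProduct.inr σ ∈ H := by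
    have hS (v : Fin m) (hv : 1 ≤ v.val) : Equiv.swap (p v) (q v) ∈ Subgroup.closure
        {σ | ∃ v : Fin m, 1 ≤ v.val ∧ Equiv.swap (p v) (q v) = σ} :=
      Subgroup.subset_closure (show _ ∈ {σ | _} from ⟨v, hv, rfl⟩)
    have htop : Subgroup.closure {σ | ∃ v : Fin m, 1 ≤ v.val ∧ Equiv.swap (p v) (q v) = σ} = ⊤ := by
      refine closure_eq_top_of_swaps _ ?_ ⟨0, hm⟩ fun b =>
        hX.exists_mem_closure_apply _ hS b.val b.2 b.2
      rintro _ ⟨v, -, rfl⟩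
      exact ⟨_, _, hX.ne v, rfl⟩
    have hle : Subgroup.closure {σ | ∃ v : Fin m, 1 ≤ v.val ∧ Equiv.swap (p v) (q v) = σ} ≤
        H.comap SemidirectProduct.inr := by
      rw [Subgroup.closure_le]
      rintro _ ⟨v, hv, rfl⟩
      have h1 := hgen v
      rw [generator, if_neg (by omega)] at h1
      exact h1
    rw [htop] at hle
    exact hle (Subgroup.mem_top σ)
  have hinl : AddSubgroup.toSubgroup.symm (H.comap SemidirectProduct.inl) = ⊤ := by
    refine eq_top_of_evenPair_mem ⟨0, hm⟩ _ fun c => ?_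
    change SemidirectProduct.inl (Multiplicative.ofAdd (evenPair c ⟨0, hm⟩)) ∈ H
    by_cases hc : c = ⟨0, hm⟩
    · rw [hc, evenPair_self, ofAdd_zero, map_one]
      exact one_mem _
    · obtain ⟨σ, h1, h2⟩ := exists_perm_apply_pair (hX.ne ⟨0, hm⟩) hc
      have h3 : SemidirectProduct.inl
          (Multiplicative.ofAdd (evenPair (p ⟨0, hm⟩) (q ⟨0, hm⟩))) ∈ H := by
        have h4 := mul_mem (hgen ⟨0, hm⟩) (inv_mem (hinr (Equiv.swap (p ⟨0, hm⟩) (q ⟨0, hm⟩))))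
        rw [generator, if_pos rfl, SemidirectProduct.mk_eq_inl_mul_inr, mul_assoc, mul_inv_cancel,
          mul_one] at h4
        exact h4
      have h5 : evenBondAction m σ (Multiplicative.ofAdd (evenPair (p ⟨0, hm⟩) (q ⟨0, hm⟩)))
          = Multiplicative.ofAdd (evenPair c ⟨0, hm⟩) := by
        change Multiplicative.ofAdd (evenBondPerm m σ (evenPair (p ⟨0, hm⟩) (q ⟨0, hm⟩))) = _
        rw [evenBondPerm_evenPair, h1, h2]
      rw [← h5, SemidirectProduct.inl_aut]
      exact mul_mem (mul_mem (hinr σ) h3) (hinr σ⁻¹)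
  rw [eq_top_iff]
  rintro g -
  rw [← SemidirectProduct.inl_left_mul_inr_right g]
  refine mul_mem ?_ (hinr _)
  have : Multiplicative.toAdd g.left ∈
      AddSubgroup.toSubgroup.symm (H.comap SemidirectProduct.inl) := hinl ▸ AddSubgroup.mem_top _
  exact this

/-- If the vertex `0` is attached to two points of the path, then the moves generate
`evenBond m ⋊ S_m`. -/
theorem vertexFlippingGroup_mulEquiv_semidirect (hX : IsEndpoints X p q) (hm : 3 ≤ m) :
    Nonempty (vertexFlippingGroup X ≃*
      Multiplicative (evenBond m) ⋊[evenBondAction m] Equiv.Perm (Fin m)) := by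
  let z : Fin m := ⟨0, by omega⟩
  -- The line of the basis vector at `0` supplies the dimension missing from the bond space. The
  -- coordinates `v ≥ 1` do not see it, whence injectivity.
  let F : (Bond m × ZMod 2) →ₗ[ZMod 2] (Fin m → ZMod 2) :=
    (bondEndpointSum p q).comp (LinearMap.fst _ _ _) +
      (LinearMap.single (ZMod 2) (fun _ => ZMod 2) z).comp (LinearMap.snd _ _ _)
  have hF (x : Bond m × ZMod 2) : F x = bondEndpointSum p q x.1 + Pi.single z x.2 := rfl
  have hinj : Function.Injective F := by
    rw [injective_iff_map_eq_zero]
    rintro ⟨x, c⟩ hx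
    obtain ⟨f, rfl⟩ := Submodule.Quotient.mk_surjective _ x
    rw [hF, bondEndpointSum_mk] at hx
    have h0 := hX.eq_zero_of_endpointSum (f := f) fun v hv => by
      have h1 := congrFun hx v
      rw [Pi.add_apply, Pi.single_eq_of_ne (fun h : v = z => by simp [h, z] at hv), add_zero] at h1
      exact h1
    have h2 : f ∈ allOnes m := (mem_allOnes_iff m f).2 ⟨f z, fun j => h0 j.val j.2 j.2⟩
    rw [LinearMap.mem_ker.1 (allOnes_le_ker_endpointSum p q h2), zero_add] at hx
    have h3 := congrFun hx z
    simp only [Pi.single_eq_same, Pi.zero_apply] at h3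
    rw [h3, (Submodule.Quotient.mk_eq_zero _).2 h2]
    rfl
  have hrank : Module.finrank (ZMod 2) (Bond m × ZMod 2)
      = Module.finrank (ZMod 2) (Fin m → ZMod 2) := by
    rw [Module.finrank_prod, finrank_bond _ (by omega), Module.finrank_self, Module.finrank_fin_fun]
    omega
  refine vertexFlippingGroup_mulEquiv X (affineAction m) (affineAction_injective m hm)
    (LinearEquiv.ofInjectiveOfFinrankEq F hinj hrank) (generator p q)
    (hX.closure_generator (by omega)) fun v x => ?_
  change F (affineAction m (generator p q v) x) = F x + F x v • nbhd X v
  rw [affineAction_apply, hF, hF]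
  -- At the vertex `0` the coordinate of `F x` has the extra summand `x.2`, which the translation
  -- part accounts for.
  by_cases hv : v.val = 0
  · obtain rfl : v = z := Fin.ext hv
    have h1 : ((generator p q z).left.toAdd : Bond m)
        = Submodule.Quotient.mk (pairVec (p z) (q z)) := rfl
    have h2 : (generator p q z).right = Equiv.swap (p z) (q z) := rfl
    simp only [h1, h2]
    rw [map_add, map_smul, hX.bondEndpointSum_bondPerm_swap, bondEndpointSum_mk,
      hX.endpointSum_pairVec, Pi.add_apply, Pi.single_eq_same, add_smul]
    abel
  · have h1 : ((generator p q v).left.toAdd : Bond m) = 0 := by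
      rw [generator, if_neg hv]
      rfl
    have h2 : (generator p q v).right = Equiv.swap (p v) (q v) := rfl
    simp only [h1, h2]
    rw [smul_zero, add_zero, hX.bondEndpointSum_bondPerm_swap, Pi.add_apply,
      Pi.single_eq_of_ne (fun h : v = z => hv (by simp [h, z])), add_zero]
    abel

end IsEndpoints

/-- For odd `n` the even part of the bond space is everything. -/
theorem nonempty_evenBond_semidirect_mulEquiv (n : ℕ) (hn : Odd n) :
    Nonempty (Multiplicative (evenBond n) ⋊[evenBondAction n] Equiv.Perm (Fin n) ≃*
      Multiplicative (Bond n) ⋊[bondAction n] Equiv.Perm (Fin n)) := by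
  let f : Multiplicative (evenBond n) ≃* Multiplicative (Bond n) :=
    AddEquiv.toMultiplicative (LinearEquiv.ofTop _ (evenBond_eq_top n hn)).toAddEquiv
  exact ⟨SemidirectProduct.congr f (MulEquiv.refl _) fun σ => MulEquiv.ext fun x => rfl⟩

/-! ### From the value of `piOne` to the group. -/

theorem exists_finset_boundary_card (m : ℕ) {l : ℕ} (i : Fin l → ℕ) (hi : StrictMono i)
    (hrange : ∀ t, i t ≤ m) (c : ℕ) (hc : piOne m i = c ∨ piOne m i = (m : ℤ) - c) :
    ∃ S ⊆ Finset.range m, S.card = c ∧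
      ∀ j, j + 1 < m → ((∃ t, j + 1 = i t) ↔ ¬ (j ∈ S ↔ j + 1 ∈ S)) := by
  obtain ⟨S, hSm, hcard, hS⟩ := exists_finset_boundary m i hi hrange
  rw [← hcard] at hc
  rcases hc with hc | hc
  · exact ⟨S, hSm, by exact_mod_cast hc, hS⟩
  · refine ⟨Finset.range m \ S, Finset.sdiff_subset, ?_, boundary_compl _ hS⟩
    rw [Finset.card_sdiff_of_subset hSm, Finset.card_range]
    omega

theorem mulEquiv_perm_of_piOne (m : ℕ) (hm : 2 ≤ m) {l : ℕ} (i : Fin l → ℕ) (hi : StrictMono i)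
    (hrange : ∀ t, i t ≤ m) (h : piOne m i ∈ ({1, (m : ℤ) - 1} : Set ℤ)) :
    Nonempty (vertexFlippingGroup (pathWithVertex m i) ≃* Equiv.Perm (Fin (m + 1))) := by
  obtain ⟨S, hSm, hcard, hS⟩ := exists_finset_boundary_card m i hi hrange 1 (by simpa using h)
  obtain ⟨a, rfl⟩ := Finset.card_eq_one.1 hcard
  have ha : a < m := by simpa using hSm
  refine (isEndpoints_pathWithVertex (n := m + 1) i (by omega) ⟨a, by omega⟩ ⟨m, by omega⟩
    (by simp only [ne_eq, Fin.mk.injEq]; omega)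
    fun j hj => ?_).vertexFlippingGroup_mulEquiv_perm hm ⟨0, by omega⟩ (by simpa using ha) (by simp)
  rw [hS j hj]
  simp [show j ≠ m by omega, show j + 1 ≠ m by omega]

theorem mulEquiv_evenBond_semidirect_of_piOne (m : ℕ) (hm : 2 ≤ m) {l : ℕ} (i : Fin l → ℕ)
    (hi : StrictMono i) (hrange : ∀ t, i t ≤ m) (hconn : (pathWithVertex m i).Connected)
    (h : piOne m i ∈ ({2, (m : ℤ) - 2} : Set ℤ)) :
    Nonempty (vertexFlippingGroup (pathWithVertex m i) ≃*
      Multiplicative (evenBond m) ⋊[evenBondAction m] Equiv.Perm (Fin m)) := by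
  obtain ⟨S, hSm, hcard, hS⟩ := exists_finset_boundary_card m i hi hrange 2 (by simpa using h)
  -- For `m = 2` the set `S` would be the whole path, which has no boundary, against connectedness.
  have hm3 : 3 ≤ m := by
    by_contra hlt
    obtain rfl : m = 2 := by omega
    obtain ⟨t, ht, ht'⟩ := exists_index_of_connected hm hconn
    obtain rfl : S = Finset.range 2 := Finset.eq_of_subset_of_card_le hSm (by simp [hcard])
    exact (hS 0 (by omega)).1 ⟨t, by omega⟩ (by simp)
  obtain ⟨a, b, hab, rfl⟩ := Finset.card_eq_two.1 hcard
  have ha : a < m := Finset.mem_range.1 (hSm (by simp))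
  have hb : b < m := Finset.mem_range.1 (hSm (by simp))
  refine (isEndpoints_pathWithVertex (n := m) i le_rfl ⟨a, ha⟩ ⟨b, hb⟩
    (by simpa using hab) fun j hj => ?_).vertexFlippingGroup_mulEquiv_semidirect hm3
  rw [hS j hj]
  simp

end FlippingPuzzle

theorem corollary6p4 (m : ℕ) (hm : 2 ≤ m) (l : ℕ) (i : Fin l → ℕ) (hi : StrictMono i)
    (hrange : ∀ t, 1 ≤ i t ∧ i t ≤ m - 1)
    (hconn : (FlippingPuzzle.pathWithVertex m i).Connected) :
    -- (i)
    ((∃ (V : Type*) (_ : Finite V) (X : SimpleGraph V), X.Connected ∧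
        Nonempty (FlippingPuzzle.pathWithVertex m i ≃g X.lineGraph)) →
      FlippingPuzzle.piOne m i ∈ ({1, 2, (m : ℤ) - 2, (m : ℤ) - 1} : Set ℤ)) ∧
    -- (ii)
    (FlippingPuzzle.piOne m i ∈ ({1, (m : ℤ) - 1} : Set ℤ) →
      Nonempty (FlippingPuzzle.vertexFlippingGroup (FlippingPuzzle.pathWithVertex m i) ≃*
        Equiv.Perm (Fin (m + 1)))) ∧
    -- (iii)
    (FlippingPuzzle.piOne m i ∈ ({2, (m : ℤ) - 2} : Set ℤ) →
      (Odd m →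
        Nonempty (FlippingPuzzle.Bond m ≃+ (Fin (m - 1) → ZMod 2)) ∧
        Nonempty (FlippingPuzzle.vertexFlippingGroup (FlippingPuzzle.pathWithVertex m i) ≃*
          Multiplicative (FlippingPuzzle.Bond m) ⋊[FlippingPuzzle.bondAction m]
            Equiv.Perm (Fin m))) ∧
      (Even m →
        Nonempty (FlippingPuzzle.evenBond m ≃+ (Fin (m - 2) → ZMod 2)) ∧
        Nonempty (FlippingPuzzle.vertexFlippingGroup (FlippingPuzzle.pathWithVertex m i) ≃*
          Multiplicative (FlippingPuzzle.evenBond m) ⋊[FlippingPuzzle.evenBondAction m]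
            Equiv.Perm (Fin m)))) := by
  have hr : ∀ t, i t ≤ m := fun t => (hrange t).2.trans (Nat.sub_le m 1)
  refine ⟨?_, FlippingPuzzle.mulEquiv_perm_of_piOne m hm i hi hr, fun h => ?_⟩
  · rintro ⟨V, _, X, _, ⟨φ⟩⟩
    exact FlippingPuzzle.piOne_mem_of_iso_lineGraph m hm i hi hr hconn X φ
  obtain ⟨f⟩ := FlippingPuzzle.mulEquiv_evenBond_semidirect_of_piOne m hm i hi hr hconn h
  refine ⟨fun hodd => ⟨?_, ?_⟩, fun heven => ⟨?_, ⟨f⟩⟩⟩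
  · exact FlippingPuzzle.nonempty_addEquiv_of_finrank _ (FlippingPuzzle.finrank_bond m (by omega))
  · obtain ⟨g⟩ := FlippingPuzzle.nonempty_evenBond_semidirect_mulEquiv m hodd
    exact ⟨f.trans g⟩
  · exact FlippingPuzzle.nonempty_addEquiv_of_finrank _
      (FlippingPuzzle.finrank_evenBond m (by omega) heven)
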